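/- **Theorem.** Let $g_b>0$, $h_a<h_b$, $\rho,\mu,\beta,C^E_{11}>0$ and $\gamma\in\mathbb R$ be the geometric and material parameters of a piezoelectric actuator of length $1$ with cross-section $[-g_b,g_b]\times[h_a,h_b]$, and put $C:=C^E_{11}+\gamma^2\beta$ and $$A:=\int_{h_a}^{h_b}\!\int_{-g_b}^{g_b}dz_2\,dz_3,\qquad I_0:=\int_{h_a}^{h_b}\!\int_{-g_b}^{g_b}z_3\,dz_2\,dz_3,\qquad I:=\int_{h_a}^{h_b}\!\int_{-g_b}^{g_b}z_3^2\,dz_2\,dz_3 .$$ Let $H^1_0(0,1):=\{f\in H^1(0,1): f(0)=0\}$ (no condition at $1$), all functions being real-valued, and let $\mathcal X:=H^1_0(0,1)^3\times L^2(0,1)^3$ carry the energy inner product $$\begin{aligned}\langle x,y\rangle_{\mathcal X}:=\int_0^1\big[&CA\,x_1'y_1'+CI\,x_2'y_2'-CI_0(x_1'y_2'+x_2'y_1')-\gamma\beta A(x_1'y_3'+x_3'y_1')+\gamma\beta I_0(x_2'y_3'+x_3'y_2')+\beta A\,x_3'y_3'\\&+\rho A\,x_4y_4+\rho I\,x_5y_5-\rho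 I_0(x_4y_5+x_5y_4)+\mu A\,x_6y_6\big]\,dz .\end{aligned}$$ Let $\mathcal A:\operatorname{Dom}(\mathcal A)\subset\mathcal X\to\mathcal X$ be the operator of the fully dynamic voltage-actuated piezoelectric actuator with voltage $V=0$, acting on the state $x=(v,w_z,q,\dot v,\dot w_z,\dot q)$: $$\mathcal A x=\Big(x_4,\;x_5,\;x_6,\;\tfrac C\rho x_1''-\tfrac{\gamma\beta}\rho x_3'',\;\tfrac C\rho x_2'',\;-\tfrac{\gamma\beta}\mu x_1''+\tfrac{\gamma\beta I_0}{\mu A}x_2''+\tfrac\beta\mu x_3''\Big),$$ where $\operatorname{Dom}(\mathcal A)$ consists of all $x\in\mathcal X$ with $x_1,x_2,x_3\in H^2(0,1)$, $x_4,x_5,x_6\in H^1_0(0,1)$ and $$\begin{aligned}CA\,x_1'(1)-CI_0\,x_2'(1)-\gamma\beta A\,x_3'(1)&=0,\\ CI\,x_2'(1)-CI_0\,x_1'(1)+\gamma\beta I_0\,x_3'(1)&=0,\\ \beta A\,x_3'(1)-\gamma\beta\big(A\,x_1'(1)-I_0\,x_2'(1)\big)&=0.\end{aligned}$$ Then $\mathcal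 A$ is the infinitesimal generator of a strongly continuous semigroup $(T(t))_{t\ge0}$ of bounded operators on $\mathcal X$, and $\|T(t)\|\le1$ for all $t\ge0$, where $\|\cdot\|$ is the operator norm induced by the energy norm. -/

import Mathlib

open MeasureTheory Set Filter Topology
open scoped ContDiff NNReal

noncomputable section

namespace PiezoActuator

/-! ### Sobolev functions on the unit interval -/

/-- The space `L²(0,1)` of real square-integrable functions. -/
abbrev L2 : Type := Lp ℝ 2 ((volume : Measure ℝ).restrict (Ioo 0 1))

/-- Smooth functions with compact support in the open interval `(0,1)`. -/
def IsTestFunction (φ : ℝ → ℝ) : Prop :=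
  ContDiff ℝ ∞ φ ∧ HasCompactSupport φ ∧ tsupport φ ⊆ Ioo 0 1

/-- `g` is the weak derivative of `f` on `(0,1)`. -/
def HasWeakDeriv (f g : L2) : Prop :=
  ∀ φ : ℝ → ℝ, IsTestFunction φ →
    ∫ z in Ioo (0 : ℝ) 1, f z * deriv φ z = -∫ z in Ioo (0 : ℝ) 1, g z * φ z

/-- `f` has a representative that is continuous on `[0,1]` and takes the value `c` at `a`
(to be used with `a ∈ [0,1]`; the continuous representative is then unique on `[0,1]`). -/
def HasBoundaryValue (f : L2) (a c : ℝ) : Prop :=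
  ∃ F : ℝ → ℝ, ContinuousOn F (Icc 0 1) ∧
    (f : ℝ → ℝ) =ᵐ[(volume : Measure ℝ).restrict (Ioo 0 1)] F ∧ F a = c

lemma L2.integrable_mul_bdd (f : L2) {φ : ℝ → ℝ} (hφ : Continuous φ)
    (hc : HasCompactSupport φ) :
    Integrable (fun z => f z * φ z) ((volume : Measure ℝ).restrict (Ioo 0 1)) := by
  obtain ⟨C, hC⟩ := hφ.bounded_above_of_compact_support hc
  have hf : Integrable (f : ℝ → ℝ) ((volume : Measure ℝ).restrict (Ioo 0 1)) :=
    (Lp.memLp f).integrable (by norm_num)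
  exact hf.mul_bdd (c := C) hφ.aestronglyMeasurable (ae_of_all _ hC)

lemma IsTestFunction.integrable_deriv {φ : ℝ → ℝ} (hφ : IsTestFunction φ) (f : L2) :
    Integrable (fun z => f z * deriv φ z) ((volume : Measure ℝ).restrict (Ioo 0 1)) :=
  L2.integrable_mul_bdd f (hφ.1.continuous_deriv (by simp)) hφ.2.1.deriv

lemma IsTestFunction.integrable {φ : ℝ → ℝ} (hφ : IsTestFunction φ) (f : L2) :
    Integrable (fun z => f z * φ z) ((volume : Measure ℝ).restrict (Ioo 0 1)) :=
  L2.integrable_mul_bdd f hφ.1.continuous hφ.2.1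

lemma L2.integral_zero_mul (φ : ℝ → ℝ) : ∫ z in Ioo (0 : ℝ) 1, (0 : L2) z * φ z = 0 := by
  rw [integral_congr_ae (g := fun _ => (0 : ℝ)), integral_zero]
  filter_upwards [Lp.coeFn_zero ℝ 2 ((volume : Measure ℝ).restrict (Ioo 0 1))] with z hz
  rw [hz, Pi.zero_apply, zero_mul]

lemma HasWeakDeriv.zero : HasWeakDeriv 0 0 := by
  intro φ _
  rw [L2.integral_zero_mul, L2.integral_zero_mul, neg_zero]

lemma HasWeakDeriv.add {f₁ f₂ g₁ g₂ : L2} (h₁ : HasWeakDeriv f₁ g₁) (h₂ : HasWeakDeriv f₂ g₂) :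
    HasWeakDeriv (f₁ + f₂) (g₁ + g₂) := by
  intro φ hφ
  have e₁ : ∫ z in Ioo (0 : ℝ) 1, (f₁ + f₂ : L2) z * deriv φ z
      = ∫ z in Ioo (0 : ℝ) 1, (f₁ z * deriv φ z + f₂ z * deriv φ z) := by
    refine integral_congr_ae ?_
    filter_upwards [Lp.coeFn_add f₁ f₂] with z hz
    rw [hz, Pi.add_apply, add_mul]
  have e₂ : ∫ z in Ioo (0 : ℝ) 1, (g₁ + g₂ : L2) z * φ z
      = ∫ z in Ioo (0 : ℝ) 1, (g₁ z * φ z + g₂ z * φ z) := by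
    refine integral_congr_ae ?_
    filter_upwards [Lp.coeFn_add g₁ g₂] with z hz
    rw [hz, Pi.add_apply, add_mul]
  rw [e₁, e₂, integral_add (hφ.integrable_deriv f₁) (hφ.integrable_deriv f₂),
    integral_add (hφ.integrable g₁) (hφ.integrable g₂), h₁ φ hφ, h₂ φ hφ]
  ring

lemma HasWeakDeriv.smul {f g : L2} (c : ℝ) (h : HasWeakDeriv f g) :
    HasWeakDeriv (c • f) (c • g) := by
  intro φ hφ
  have e₁ : ∫ z in Ioo (0 : ℝ) 1, (c • f : L2) z * deriv φ z
      = ∫ z in Ioo (0 : ℝ) 1, c * (f z * deriv φ z) := by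
    refine integral_congr_ae ?_
    filter_upwards [Lp.coeFn_smul c f] with z hz
    rw [hz, Pi.smul_apply, smul_eq_mul, mul_assoc]
  have e₂ : ∫ z in Ioo (0 : ℝ) 1, (c • g : L2) z * φ z
      = ∫ z in Ioo (0 : ℝ) 1, c * (g z * φ z) := by
    refine integral_congr_ae ?_
    filter_upwards [Lp.coeFn_smul c g] with z hz
    rw [hz, Pi.smul_apply, smul_eq_mul, mul_assoc]
  rw [e₁, e₂, integral_const_mul, integral_const_mul, h φ hφ]
  ring

lemma eq_zero_of_forall_test {f : L2}
    (h : ∀ φ : ℝ → ℝ, IsTestFunction φ → ∫ z in Ioo (0 : ℝ) 1, f z * φ z = 0) : f = 0 := by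
  have hf : Integrable (f : ℝ → ℝ) ((volume : Measure ℝ).restrict (Ioo 0 1)) :=
    (Lp.memLp f).integrable (by norm_num)
  have hae := (isOpen_Ioo (a := (0 : ℝ)) (b := 1)).ae_eq_zero_of_integral_contDiff_smul_eq_zero
    (μ := (volume : Measure ℝ).restrict (Ioo 0 1)) (f := (f : ℝ → ℝ))
    (hf.locallyIntegrable.locallyIntegrableOn _)
    (fun g hg hgc hgs => by
      refine Eq.trans (integral_congr_ae (ae_of_all _ fun z => ?_)) (h g ⟨hg, hgc, hgs⟩)
      exact mul_comm _ _)
  refine Lp.ext ?_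
  filter_upwards [hae, ae_restrict_mem measurableSet_Ioo,
    Lp.coeFn_zero ℝ 2 ((volume : Measure ℝ).restrict (Ioo 0 1))] with z h1 h2 h3
  rw [h1 h2, h3, Pi.zero_apply]

lemma HasWeakDeriv.unique {f g₁ g₂ : L2} (h₁ : HasWeakDeriv f g₁) (h₂ : HasWeakDeriv f g₂) :
    g₁ = g₂ := by
  have h := h₁.add (h₂.smul (-1))
  have h0 : f + (-1 : ℝ) • f = 0 := by simp
  have h1 : g₁ + (-1 : ℝ) • g₂ = g₁ - g₂ := by simp [sub_eq_add_neg]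
  rw [h0, h1] at h
  refine sub_eq_zero.mp (eq_zero_of_forall_test fun φ hφ => ?_)
  have := h φ hφ
  rw [L2.integral_zero_mul] at this
  exact neg_eq_zero.mp this.symm

lemma HasBoundaryValue.zero (a : ℝ) : HasBoundaryValue 0 a 0 :=
  ⟨fun _ => 0, continuousOn_const, Lp.coeFn_zero ℝ 2 _, rfl⟩

lemma HasBoundaryValue.add {f₁ f₂ : L2} {a c₁ c₂ : ℝ} (h₁ : HasBoundaryValue f₁ a c₁)
    (h₂ : HasBoundaryValue f₂ a c₂) : HasBoundaryValue (f₁ + f₂) a (c₁ + c₂) := by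
  obtain ⟨F₁, hF₁, he₁, hv₁⟩ := h₁
  obtain ⟨F₂, hF₂, he₂, hv₂⟩ := h₂
  exact ⟨F₁ + F₂, hF₁.add hF₂, (Lp.coeFn_add f₁ f₂).trans (he₁.add he₂), by simp [hv₁, hv₂]⟩

lemma HasBoundaryValue.smul {f : L2} {a c : ℝ} (r : ℝ) (h : HasBoundaryValue f a c) :
    HasBoundaryValue (r • f) a (r * c) := by
  obtain ⟨F, hF, he, hv⟩ := h
  exact ⟨r • F, hF.const_smul r, (Lp.coeFn_smul r f).trans (he.const_smul r), by simp [hv]⟩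

/-- The Sobolev space `H¹(0,1)`. -/
def H1 : Submodule ℝ L2 where
  carrier := {f | ∃ g : L2, HasWeakDeriv f g}
  zero_mem' := ⟨0, HasWeakDeriv.zero⟩
  add_mem' := fun ⟨g₁, h₁⟩ ⟨g₂, h₂⟩ => ⟨g₁ + g₂, h₁.add h₂⟩
  smul_mem' := fun c _ ⟨g, h⟩ => ⟨c • g, h.smul c⟩

/-- The space `H¹₀(0,1) = {f ∈ H¹(0,1) | f(0) = 0}`; there is no condition at the endpoint `1`. -/
def H10 : Submodule ℝ L2 where
  carrier := {f | f ∈ H1 ∧ HasBoundaryValue f 0 0}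
  zero_mem' := ⟨H1.zero_mem, HasBoundaryValue.zero 0⟩
  add_mem' := fun ⟨h₁, b₁⟩ ⟨h₂, b₂⟩ => ⟨H1.add_mem h₁ h₂, by simpa using b₁.add b₂⟩
  smul_mem' := fun c _ ⟨h, b⟩ => ⟨H1.smul_mem c h, by simpa using b.smul c⟩

open Classical in
/-- The weak derivative of `f` (which is unique) if `f ∈ H¹(0,1)`, and `0` otherwise. -/
def weakDeriv (f : L2) : L2 :=
  if h : ∃ g : L2, HasWeakDeriv f g then h.choose else 0

lemma hasWeakDeriv_weakDeriv {f : L2} (hf : f ∈ H1) : HasWeakDeriv f (weakDeriv f) := by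
  have h : ∃ g : L2, HasWeakDeriv f g := hf
  rw [weakDeriv, dif_pos h]
  exact h.choose_spec

lemma HasWeakDeriv.weakDeriv_eq {f g : L2} (h : HasWeakDeriv f g) : weakDeriv f = g :=
  (hasWeakDeriv_weakDeriv ⟨g, h⟩).unique h

lemma weakDeriv_add {f g : L2} (hf : f ∈ H1) (hg : g ∈ H1) :
    weakDeriv (f + g) = weakDeriv f + weakDeriv g :=
  ((hasWeakDeriv_weakDeriv hf).add (hasWeakDeriv_weakDeriv hg)).weakDeriv_eq

lemma weakDeriv_smul (c : ℝ) {f : L2} (hf : f ∈ H1) :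
    weakDeriv (c • f) = c • weakDeriv f :=
  ((hasWeakDeriv_weakDeriv hf).smul c).weakDeriv_eq

lemma weakDeriv_zero : weakDeriv 0 = 0 := HasWeakDeriv.zero.weakDeriv_eq

/-- A smooth function with compact support in `(0,1)` and integral zero has a primitive of the
same kind. -/
lemma IsTestFunction.exists_primitive {ψ : ℝ → ℝ} (hψ : IsTestFunction ψ)
    (h0 : ∫ z in Ioo (0 : ℝ) 1, ψ z = 0) : ∃ φ, IsTestFunction φ ∧ deriv φ = ψ := by
  obtain ⟨hs, hc, hsub⟩ := hψ
  have hcont : Continuous ψ := hs.continuous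
  have hderiv : ∀ z, HasDerivAt (fun x => ∫ t in (0 : ℝ)..x, ψ t) (ψ z) z := fun z =>
    intervalIntegral.integral_hasDerivAt_right (hcont.intervalIntegrable _ _)
      (hcont.stronglyMeasurableAtFilter _ _) hcont.continuousAt
  have hd : deriv (fun x => ∫ t in (0 : ℝ)..x, ψ t) = ψ := funext fun z => (hderiv z).deriv
  have h01 : ∫ t in (0 : ℝ)..1, ψ t = 0 := by
    rw [intervalIntegral.integral_of_le zero_le_one, integral_Ioc_eq_integral_Ioo, h0]
  -- the support of `ψ` lies in some `[a, b]` with `0 < a ≤ b < 1`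
  obtain ⟨a, b, ha0, ha1, hb0, hb1, hab⟩ : ∃ a b : ℝ, 0 < a ∧ a < 1 ∧ 0 < b ∧ b < 1 ∧
      tsupport ψ ⊆ Icc a b := by
    rcases (tsupport ψ).eq_empty_or_nonempty with he | hne
    · exact ⟨1 / 2, 1 / 2, by norm_num, by norm_num, by norm_num, by norm_num, by simp [he]⟩
    · obtain ⟨a, ham, hal⟩ := hc.isCompact.exists_isLeast hne
      obtain ⟨b, hbm, hbl⟩ := hc.isCompact.exists_isGreatest hne
      exact ⟨a, b, (hsub ham).1, (hsub ham).2, (hsub hbm).1, (hsub hbm).2,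
        fun z hz => ⟨hal hz, hbl hz⟩⟩
  have hzero : ∀ z, z ∉ Icc a b → ψ z = 0 := fun z hz =>
    image_eq_zero_of_notMem_tsupport fun h => hz (hab h)
  have hleft : ∀ z, z < a → ∫ t in (0 : ℝ)..z, ψ t = 0 := by
    intro z hz
    refine intervalIntegral.integral_zero_ae (ae_of_all _ fun t ht => hzero t fun h => ?_)
    have : t ≤ max 0 z := by
      rw [uIoc, mem_Ioc] at ht
      exact ht.2
    exact absurd (h.1.trans this) (not_le.mpr (max_lt ha0 hz))
  have hright : ∀ z, b < z → ∫ t in (0 : ℝ)..z, ψ t = 0 := by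
    intro z hz
    rw [← intervalIntegral.integral_add_adjacent_intervals (hcont.intervalIntegrable 0 1)
      (hcont.intervalIntegrable 1 z), h01, zero_add]
    refine intervalIntegral.integral_zero_ae (ae_of_all _ fun t ht => hzero t fun h => ?_)
    have : min 1 z < t := by
      rw [uIoc, mem_Ioc] at ht
      exact ht.1
    exact absurd (lt_of_lt_of_le this h.2) (not_lt.mpr (le_of_lt (lt_min hb1 hz)))
  have hts : tsupport (fun x => ∫ t in (0 : ℝ)..x, ψ t) ⊆ Icc a b := by
    refine closure_minimal (fun z hz => ?_) isClosed_Icc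
    by_contra hn
    rw [mem_Icc, not_and_or, not_le, not_le] at hn
    exact hz (hn.elim (hleft z) (hright z))
  refine ⟨fun x => ∫ t in (0 : ℝ)..x, ψ t, ⟨?_, ?_, ?_⟩, hd⟩
  · rw [contDiff_infty_iff_deriv, hd]
    exact ⟨fun z => (hderiv z).differentiableAt, hs⟩
  · exact isCompact_Icc.of_isClosed_subset (isClosed_tsupport _) hts
  · exact hts.trans fun z hz => ⟨lt_of_lt_of_le ha0 hz.1, lt_of_le_of_lt hz.2 hb1⟩

lemma exists_testFunction_integral_one :
    ∃ φ : ℝ → ℝ, IsTestFunction φ ∧ ∫ z in Ioo (0 : ℝ) 1, φ z = 1 := by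
  let b : ContDiffBump (1 / 2 : ℝ) := ⟨1 / 8, 1 / 4, by norm_num, by norm_num⟩
  have hsub : tsupport (b.normed volume) ⊆ Ioo 0 1 := by
    rw [b.tsupport_normed_eq, Real.closedBall_eq_Icc]
    intro z hz
    have h1 : (1 / 2 : ℝ) - 1 / 4 ≤ z := hz.1
    have h2 : z ≤ (1 / 2 : ℝ) + 1 / 4 := hz.2
    constructor <;> linarith
  refine ⟨b.normed volume, ⟨b.contDiff_normed, b.hasCompactSupport_normed, hsub⟩, ?_⟩
  rw [setIntegral_eq_integral_of_forall_compl_eq_zero, b.integral_normed]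
  intro z hz
  exact image_eq_zero_of_notMem_tsupport fun h => hz (hsub h)

/-- A Sobolev function with vanishing weak derivative and vanishing boundary value is zero. -/
lemma eq_zero_of_weakDeriv_eq_zero {f : L2} (hf : f ∈ H10) (h : weakDeriv f = 0) : f = 0 := by
  have hw : HasWeakDeriv f 0 := h ▸ hasWeakDeriv_weakDeriv hf.1
  obtain ⟨ψ₀, hψ₀, hone⟩ := exists_testFunction_integral_one
  set c : ℝ := ∫ z in Ioo (0 : ℝ) 1, f z * ψ₀ z with hc
  have hmem : MemLp (fun _ : ℝ => c) 2 ((volume : Measure ℝ).restrict (Ioo 0 1)) := memLp_const c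
  -- `f` is almost everywhere equal to the constant `c`
  have hconst : f - hmem.toLp _ = 0 := by
    refine eq_zero_of_forall_test fun φ hφ => ?_
    set m : ℝ := ∫ z in Ioo (0 : ℝ) 1, φ z with hm
    have hint : ∀ {χ : ℝ → ℝ}, IsTestFunction χ →
        Integrable χ ((volume : Measure ℝ).restrict (Ioo 0 1)) := fun hχ =>
      (hχ.1.continuous.integrable_of_hasCompactSupport hχ.2.1).integrableOn
    have hdiff : IsTestFunction (fun z => φ z - m * ψ₀ z) := by
      refine ⟨hφ.1.sub (contDiff_const.mul hψ₀.1), hφ.2.1.sub (hψ₀.2.1.mul_left), ?_⟩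
      refine (tsupport_sub _ _).trans (union_subset hφ.2.2 ?_)
      exact (closure_mono (Function.support_mul_subset_right _ _)).trans hψ₀.2.2
    obtain ⟨χ, hχ, hχd⟩ := hdiff.exists_primitive (by
      rw [integral_sub (hint hφ) ((hint hψ₀).const_mul m), integral_const_mul, hone, mul_one,
        hm, sub_self])
    have key := hw χ hχ
    rw [L2.integral_zero_mul, hχd, neg_zero] at key
    have e₁ : ∫ z in Ioo (0 : ℝ) 1, f z * (φ z - m * ψ₀ z)
        = (∫ z in Ioo (0 : ℝ) 1, f z * φ z) - m * c := by
      rw [hc, ← integral_const_mul, ← integral_sub (hφ.integrable f)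
        ((hψ₀.integrable f).const_mul m)]
      exact integral_congr_ae (ae_of_all _ fun z => by ring)
    have e₂ : ∫ z in Ioo (0 : ℝ) 1, (f - hmem.toLp _ : L2) z * φ z
        = ∫ z in Ioo (0 : ℝ) 1, (f z * φ z - c * φ z) := by
      refine integral_congr_ae ?_
      filter_upwards [Lp.coeFn_sub f (hmem.toLp _), hmem.coeFn_toLp] with z h1 h2
      rw [h1, Pi.sub_apply, h2, sub_mul]
    rw [e₂, integral_sub (hφ.integrable f) ((hint hφ).const_mul c), integral_const_mul, ← hm]
    rw [e₁] at key
    linarith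
  have hfc : (f : ℝ → ℝ) =ᵐ[(volume : Measure ℝ).restrict (Ioo 0 1)] fun _ => c := by
    rw [sub_eq_zero.mp hconst]
    exact hmem.coeFn_toLp
  obtain ⟨F, hF, hfF, hF0⟩ := hf.2
  have hFc : F =ᵐ[(volume : Measure ℝ).restrict (Ioo 0 1)] fun _ => c := hfF.symm.trans hfc
  have hon : EqOn F (fun _ => c) (Ioo 0 1) :=
    Measure.eqOn_open_of_ae_eq hFc isOpen_Ioo (hF.mono Ioo_subset_Icc_self) continuousOn_const
  have hcl : EqOn F (fun _ => c) (Icc 0 1) :=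
    hon.of_subset_closure hF continuousOn_const Ioo_subset_Icc_self
      (by rw [closure_Ioo (zero_ne_one' ℝ)])
  have hc0 : c = 0 := by
    rw [← hF0]
    exact (hcl ⟨le_refl _, zero_le_one⟩).symm
  refine Lp.ext ?_
  filter_upwards [hfc, Lp.coeFn_zero ℝ 2 ((volume : Measure ℝ).restrict (Ioo 0 1))] with z h1 h2
  rw [h1, h2, hc0, Pi.zero_apply]

/-! ### Physical parameters -/

/-- Geometric and material parameters of the actuator: half-width `gb`, lower and upper
heights `ha < hb`, mass density `ρ`, magnetic permeability `μ`, piezoelectric constant `γ`,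
impermittivity `β` and elastic stiffness `C11`. -/
structure Params where
  gb : ℝ
  ha : ℝ
  hb : ℝ
  ρ : ℝ
  μ : ℝ
  γ : ℝ
  β : ℝ
  C11 : ℝ
  gb_pos : 0 < gb
  ha_lt_hb : ha < hb
  ρ_pos : 0 < ρ
  μ_pos : 0 < μ
  β_pos : 0 < β
  C11_pos : 0 < C11

namespace Params

variable (p : Params)

/-- The reinforced stiffness constant `C`. -/
def C : ℝ := p.C11 + p.γ ^ 2 * p.β

/-- The area `A` of the cross-section `[-gb, gb] × [ha, hb]`. -/
def A : ℝ := ∫ _z₃ in p.ha..p.hb, ∫ _z₂ in (-p.gb)..p.gb, (1 : ℝ)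

/-- The second moment `I` of the cross-section. -/
def I : ℝ := ∫ z₃ in p.ha..p.hb, ∫ _z₂ in (-p.gb)..p.gb, z₃ ^ 2

/-- The first moment `I₀` of the cross-section. -/
def I₀ : ℝ := ∫ z₃ in p.ha..p.hb, ∫ _z₂ in (-p.gb)..p.gb, z₃

lemma A_eq : p.A = 2 * p.gb * (p.hb - p.ha) := by
  simp only [A, intervalIntegral.integral_const, smul_eq_mul, sub_neg_eq_add, mul_one]
  ring

lemma I_eq : p.I = 2 / 3 * p.gb * (p.hb ^ 3 - p.ha ^ 3) := by
  simp only [I, intervalIntegral.integral_const, smul_eq_mul, sub_neg_eq_add,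
    intervalIntegral.integral_const_mul, integral_pow]
  push_cast
  ring

lemma I₀_eq : p.I₀ = p.gb * (p.hb ^ 2 - p.ha ^ 2) := by
  simp only [I₀, intervalIntegral.integral_const, smul_eq_mul, sub_neg_eq_add]
  rw [intervalIntegral.integral_const_mul, integral_id]
  ring

lemma A_pos : 0 < p.A := by
  rw [A_eq]
  have h1 := p.gb_pos
  have h2 := sub_pos.mpr p.ha_lt_hb
  positivity

lemma det_pos : 0 < p.A * p.I - p.I₀ ^ 2 := by
  have h1 := p.gb_pos
  have h2 := sub_pos.mpr p.ha_lt_hb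
  have h : p.A * p.I - p.I₀ ^ 2 = p.gb ^ 2 * (p.hb - p.ha) ^ 4 / 3 := by
    rw [A_eq, I_eq, I₀_eq]
    ring
  rw [h]
  positivity

lemma C_pos : 0 < p.C := by
  have h1 := p.C11_pos
  have h2 := p.β_pos
  unfold C
  positivity

end Params

/-! ### The state space with the energy inner product -/

/-- The state space `𝒳 = H¹₀(0,1)³ × L²(0,1)³`. For `x : StateSpace p`, the components
`x₁, x₂, x₃` are `x.1 0, x.1 1, x.1 2` and `x₄, x₅, x₆` are `x.2 0, x.2 1, x.2 2`. -/
def StateSpace (_p : Params) : Type := (Fin 3 → H10) × (Fin 3 → L2)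

variable {p : Params}

instance : AddCommGroup (StateSpace p) := inferInstanceAs (AddCommGroup ((Fin 3 → H10) × (Fin 3 → L2)))

instance : Module ℝ (StateSpace p) := inferInstanceAs (Module ℝ ((Fin 3 → H10) × (Fin 3 → L2)))

/-- The spatial derivatives `x₁', x₂', x₃'` of the first three components of a state. -/
def StateSpace.D (x : StateSpace p) (i : Fin 3) : L2 := weakDeriv (x.1 i)

lemma StateSpace.D_add (x y : StateSpace p) (i : Fin 3) : (x + y).D i = x.D i + y.D i :=
  weakDeriv_add (x.1 i).2.1 (y.1 i).2.1

lemma StateSpace.D_smul (c : ℝ) (x : StateSpace p) (i : Fin 3) : (c • x).D i = c • x.D i :=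
  weakDeriv_smul c (x.1 i).2.1

lemma StateSpace.D_zero (i : Fin 3) : (0 : StateSpace p).D i = 0 := weakDeriv_zero

/-- The energy inner product on the state space. -/
def energyInner (x y : StateSpace p) : ℝ :=
  ∫ z in Ioo (0 : ℝ) 1,
    (p.C * p.A * (x.D 0 z * y.D 0 z) + p.C * p.I * (x.D 1 z * y.D 1 z)
      - p.C * p.I₀ * (x.D 0 z * y.D 1 z + x.D 1 z * y.D 0 z)
      - p.γ * p.β * p.A * (x.D 0 z * y.D 2 z + x.D 2 z * y.D 0 z)
      + p.γ * p.β * p.I₀ * (x.D 1 z * y.D 2 z + x.D 2 z * y.D 1 z)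
      + p.β * p.A * (x.D 2 z * y.D 2 z)
      + p.ρ * p.A * (x.2 0 z * y.2 0 z) + p.ρ * p.I * (x.2 1 z * y.2 1 z)
      - p.ρ * p.I₀ * (x.2 0 z * y.2 1 z + x.2 1 z * y.2 0 z)
      + p.μ * p.A * (x.2 2 z * y.2 2 z))

lemma L2.integrable_mul (f g : L2) :
    Integrable (fun z => f z * g z) ((volume : Measure ℝ).restrict (Ioo 0 1)) := by
  simpa [mul_comm] using L2.integrable_inner (𝕜 := ℝ) f g

lemma L2.inner_eq (f g : L2) : inner ℝ f g = ∫ z in Ioo (0 : ℝ) 1, f z * g z := by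
  rw [L2.inner_def]
  exact integral_congr_ae (ae_of_all _ fun z => by simp [mul_comm])

lemma energyInner_eq (x y : StateSpace p) :
    energyInner x y =
      p.C * p.A * inner ℝ (x.D 0) (y.D 0) + p.C * p.I * inner ℝ (x.D 1) (y.D 1)
      - p.C * p.I₀ * (inner ℝ (x.D 0) (y.D 1) + inner ℝ (x.D 1) (y.D 0))
      - p.γ * p.β * p.A * (inner ℝ (x.D 0) (y.D 2) + inner ℝ (x.D 2) (y.D 0))
      + p.γ * p.β * p.I₀ * (inner ℝ (x.D 1) (y.D 2) + inner ℝ (x.D 2) (y.D 1))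
      + p.β * p.A * inner ℝ (x.D 2) (y.D 2)
      + p.ρ * p.A * inner ℝ (x.2 0) (y.2 0) + p.ρ * p.I * inner ℝ (x.2 1) (y.2 1)
      - p.ρ * p.I₀ * (inner ℝ (x.2 0) (y.2 1) + inner ℝ (x.2 1) (y.2 0))
      + p.μ * p.A * inner ℝ (x.2 2) (y.2 2) := by
  have hD : ∀ i j, Integrable (fun z => x.D i z * y.D j z)
    ((volume : Measure ℝ).restrict (Ioo 0 1)) := fun i j => L2.integrable_mul _ _
  have hV : ∀ i j, Integrable (fun z => x.2 i z * y.2 j z)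
    ((volume : Measure ℝ).restrict (Ioo 0 1)) := fun i j => L2.integrable_mul _ _
  simp only [L2.inner_eq, energyInner]
  have t1 := (hD 0 0).const_mul (p.C * p.A)
  have t2 := (hD 1 1).const_mul (p.C * p.I)
  have t3 := ((hD 0 1).add (hD 1 0)).const_mul (p.C * p.I₀)
  have t4 := ((hD 0 2).add (hD 2 0)).const_mul (p.γ * p.β * p.A)
  have t5 := ((hD 1 2).add (hD 2 1)).const_mul (p.γ * p.β * p.I₀)
  have t6 := (hD 2 2).const_mul (p.β * p.A)
  have t7 := (hV 0 0).const_mul (p.ρ * p.A)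
  have t8 := (hV 1 1).const_mul (p.ρ * p.I)
  have t9 := ((hV 0 1).add (hV 1 0)).const_mul (p.ρ * p.I₀)
  have t10 := (hV 2 2).const_mul (p.μ * p.A)
  have s2 := t1.add t2
  have s3 := s2.sub t3
  have s4 := s3.sub t4
  have s5 := s4.add t5
  have s6 := s5.add t6
  have s7 := s6.add t7
  have s8 := s7.add t8
  have s9 := s8.sub t9
  refine (integral_add s9 t10).trans ?_
  refine congrArg₂ (· + ·) ?_ (integral_const_mul _ _)
  refine (integral_sub s8 t9).trans ?_
  refine congrArg₂ (· - ·) ?_ ((integral_const_mul _ _).trans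
    (congrArg _ (integral_add (hV 0 1) (hV 1 0))))
  refine (integral_add s7 t8).trans ?_
  refine congrArg₂ (· + ·) ?_ (integral_const_mul _ _)
  refine (integral_add s6 t7).trans ?_
  refine congrArg₂ (· + ·) ?_ (integral_const_mul _ _)
  refine (integral_add s5 t6).trans ?_
  refine congrArg₂ (· + ·) ?_ (integral_const_mul _ _)
  refine (integral_add s4 t5).trans ?_
  refine congrArg₂ (· + ·) ?_ ((integral_const_mul _ _).trans
    (congrArg _ (integral_add (hD 1 2) (hD 2 1))))
  refine (integral_sub s3 t4).trans ?_
  refine congrArg₂ (· - ·) ?_ ((integral_const_mul _ _).trans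
    (congrArg _ (integral_add (hD 0 2) (hD 2 0))))
  refine (integral_sub s2 t3).trans ?_
  refine congrArg₂ (· - ·) ?_ ((integral_const_mul _ _).trans
    (congrArg _ (integral_add (hD 0 1) (hD 1 0))))
  refine (integral_add t1 t2).trans ?_
  exact congrArg₂ (· + ·) (integral_const_mul _ _) (integral_const_mul _ _)

/-- Completion of squares in the energy. -/
lemma energyInner_self (x : StateSpace p) :
    energyInner x x =
      p.C11 * p.A * ‖x.D 0 - (p.I₀ / p.A) • x.D 1‖ ^ 2
      + p.β * p.A * ‖x.D 2 - p.γ • (x.D 0 - (p.I₀ / p.A) • x.D 1)‖ ^ 2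
      + p.C * ((p.A * p.I - p.I₀ ^ 2) / p.A) * ‖x.D 1‖ ^ 2
      + p.ρ * p.A * ‖x.2 0 - (p.I₀ / p.A) • x.2 1‖ ^ 2
      + p.ρ * ((p.A * p.I - p.I₀ ^ 2) / p.A) * ‖x.2 1‖ ^ 2
      + p.μ * p.A * ‖x.2 2‖ ^ 2 := by
  have hA : p.A ≠ 0 := p.A_pos.ne'
  rw [energyInner_eq]
  simp only [← real_inner_self_eq_norm_sq, inner_sub_left, inner_sub_right, real_inner_smul_left,
    real_inner_smul_right]
  rw [real_inner_comm (x.D 0) (x.D 1), real_inner_comm (x.D 0) (x.D 2),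
    real_inner_comm (x.D 1) (x.D 2), real_inner_comm (x.2 0) (x.2 1), Params.C]
  field_simp
  ring

/-- The energy form is a genuine (positive definite) inner product. -/
@[reducible] def energyCore (p : Params) : InnerProductSpace.Core ℝ (StateSpace p) where
  inner := energyInner
  conj_inner_symm x y := by
    simp only [energyInner, conj_trivial]
    exact integral_congr_ae (ae_of_all _ fun z => by ring)
  re_inner_nonneg x := by
    have h1 := p.A_pos
    have h2 := div_pos p.det_pos p.A_pos
    have h3 := p.C_pos
    have h4 := p.C11_pos
    have h5 := p.β_pos
    have h6 := p.ρ_pos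
    have h7 := p.μ_pos
    change 0 ≤ energyInner x x
    rw [energyInner_self]
    positivity
  add_left x y z := by
    have e : ∀ i, (x + y).2 i = x.2 i + y.2 i := fun _ => rfl
    simp only [energyInner_eq, StateSpace.D_add, e, inner_add_left]
    ring
  smul_left x y r := by
    have e : ∀ i, (r • x).2 i = r • x.2 i := fun _ => rfl
    simp only [energyInner_eq, StateSpace.D_smul, e, real_inner_smul_left, conj_trivial]
    ring
  definite x hx := by
    have h1 := p.A_pos
    have h2 := div_pos p.det_pos p.A_pos
    have h3 := p.C_pos
    have h4 := p.C11_pos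
    have h5 := p.β_pos
    have h6 := p.ρ_pos
    have h7 := p.μ_pos
    have hx' : energyInner x x = 0 := hx
    rw [energyInner_self] at hx'
    have n1 : 0 ≤ p.C11 * p.A * ‖x.D 0 - (p.I₀ / p.A) • x.D 1‖ ^ 2 := by positivity
    have n2 : 0 ≤ p.β * p.A * ‖x.D 2 - p.γ • (x.D 0 - (p.I₀ / p.A) • x.D 1)‖ ^ 2 := by positivity
    have n3 : 0 ≤ p.C * ((p.A * p.I - p.I₀ ^ 2) / p.A) * ‖x.D 1‖ ^ 2 := by positivity
    have n4 : 0 ≤ p.ρ * p.A * ‖x.2 0 - (p.I₀ / p.A) • x.2 1‖ ^ 2 := by positivity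
    have n5 : 0 ≤ p.ρ * ((p.A * p.I - p.I₀ ^ 2) / p.A) * ‖x.2 1‖ ^ 2 := by positivity
    have n6 : 0 ≤ p.μ * p.A * ‖x.2 2‖ ^ 2 := by positivity
    have key : ∀ {c : ℝ} {u : L2}, 0 < c → c * ‖u‖ ^ 2 = 0 → u = 0 := by
      intro c u hc h
      rcases mul_eq_zero.mp h with h | h
      · exact absurd h hc.ne'
      · exact norm_eq_zero.mp (pow_eq_zero_iff two_ne_zero |>.mp h)
    have z1 := key (by positivity) (le_antisymm (by linarith) n1)
    have z2 := key (by positivity) (le_antisymm (by linarith) n2)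
    have z3 := key (by positivity) (le_antisymm (by linarith) n3)
    have z4 := key (by positivity) (le_antisymm (by linarith) n4)
    have z5 := key (by positivity) (le_antisymm (by linarith) n5)
    have z6 := key (by positivity) (le_antisymm (by linarith) n6)
    rw [z1, smul_zero, sub_zero] at z2
    rw [z3, smul_zero, sub_zero] at z1
    rw [z5, smul_zero, sub_zero] at z4
    refine Prod.ext (funext fun i => Subtype.ext ?_) (funext fun i => ?_)
    · refine eq_zero_of_weakDeriv_eq_zero (x.1 i).2 ?_
      fin_cases i
      · exact z1
      · exact z3
      · exact z2
    · fin_cases i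
      · exact z4
      · exact z5
      · exact z6

instance : NormedAddCommGroup (StateSpace p) := (energyCore p).toNormedAddCommGroup

instance : InnerProductSpace ℝ (StateSpace p) := InnerProductSpace.ofCore (energyCore p).toCore

/-! ### The operator -/

/-- The domain of the operator for zero voltage: `x₁, x₂, x₃ ∈ H²(0,1) ∩ H¹₀(0,1)`,
`x₄, x₅, x₆ ∈ H¹₀(0,1)`, and the three natural boundary conditions at `z = 1`, in which `d i`
is the value at `1` of the derivative of the component `x.1 i`. -/
def opDomain (p : Params) : Submodule ℝ (StateSpace p) where
  carrier := {x | (∀ i, x.D i ∈ H1) ∧ (∀ i, x.2 i ∈ H10) ∧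
    ∃ d : Fin 3 → ℝ, (∀ i, HasBoundaryValue (x.D i) 1 (d i)) ∧
      p.C * p.A * d 0 - p.C * p.I₀ * d 1 - p.γ * p.β * p.A * d 2 = 0 ∧
      p.C * p.I * d 1 - p.C * p.I₀ * d 0 + p.γ * p.β * p.I₀ * d 2 = 0 ∧
      p.β * p.A * d 2 - p.γ * p.β * (p.A * d 0 - p.I₀ * d 1) = 0}
  zero_mem' := by
    refine ⟨fun i => ?_, fun i => H10.zero_mem, 0, fun i => ?_, by simp, by simp, by simp⟩
    · rw [StateSpace.D_zero]
      exact H1.zero_mem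
    · rw [StateSpace.D_zero]
      exact HasBoundaryValue.zero 1
  add_mem' := by
    rintro x y ⟨hx, hx', d, hd, a1, a2, a3⟩ ⟨hy, hy', e, he, b1, b2, b3⟩
    refine ⟨fun i => ?_, fun i => H10.add_mem (hx' i) (hy' i), d + e, fun i => ?_, ?_, ?_, ?_⟩
    · rw [StateSpace.D_add]
      exact H1.add_mem (hx i) (hy i)
    · rw [StateSpace.D_add]
      exact (hd i).add (he i)
    · simp only [Pi.add_apply]
      linear_combination a1 + b1
    · simp only [Pi.add_apply]
      linear_combination a2 + b2
    · simp only [Pi.add_apply]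
      linear_combination a3 + b3
  smul_mem' := by
    rintro c x ⟨hx, hx', d, hd, a1, a2, a3⟩
    refine ⟨fun i => ?_, fun i => H10.smul_mem c (hx' i), fun i => c * d i, fun i => ?_,
      ?_, ?_, ?_⟩
    · rw [StateSpace.D_smul]
      exact H1.smul_mem c (hx i)
    · rw [StateSpace.D_smul]
      exact (hd i).smul c
    · linear_combination c * a1
    · linear_combination c * a2
    · linear_combination c * a3

/-- The coefficient matrix of `∂²` in the last three rows of the operator. -/
def coeff (p : Params) : Matrix (Fin 3) (Fin 3) ℝ :=
  !![p.C / p.ρ, 0, -(p.γ * p.β / p.ρ);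
     0, p.C / p.ρ, 0;
     -(p.γ * p.β / p.μ), p.γ * p.β * p.I₀ / (p.μ * p.A), p.β / p.μ]

/-- The operator `𝒜` of the actuator with zero voltage, as an unbounded operator on the state
space: `𝒜 x = (x₄, x₅, x₆, (C/ρ) x₁'' - (γβ/ρ) x₃'', (C/ρ) x₂'',
-(γβ/μ) x₁'' + (γβI₀/(μA)) x₂'' + (β/μ) x₃'')`. -/
def op (p : Params) : StateSpace p →ₗ.[ℝ] StateSpace p where
  domain := opDomain p
  toFun :=
    { toFun := fun x =>
        (fun i => ⟨x.1.2 i, x.2.2.1 i⟩, fun i => ∑ j, coeff p i j • weakDeriv (x.1.D j))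
      map_add' := by
        rintro ⟨x, hx⟩ ⟨y, hy⟩
        refine Prod.ext rfl (funext fun i => ?_)
        change ∑ j, coeff p i j • weakDeriv ((x + y).D j)
          = ∑ j, coeff p i j • weakDeriv (x.D j) + ∑ j, coeff p i j • weakDeriv (y.D j)
        rw [← Finset.sum_add_distrib]
        refine Finset.sum_congr rfl fun j _ => ?_
        rw [StateSpace.D_add, weakDeriv_add (hx.1 j) (hy.1 j), smul_add]
      map_smul' := by
        rintro c ⟨x, hx⟩
        refine Prod.ext rfl (funext fun i => ?_)
        change ∑ j, coeff p i j • weakDeriv ((c • x).D j)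
          = c • ∑ j, coeff p i j • weakDeriv (x.D j)
        rw [Finset.smul_sum]
        refine Finset.sum_congr rfl fun j _ => ?_
        rw [StateSpace.D_smul, weakDeriv_smul c (hx.1 j), smul_comm] }

/-! ### Strongly continuous semigroups -/

/-- A strongly continuous semigroup (`C₀`-semigroup) of bounded operators. -/
structure C0Semigroup (X : Type*) [NormedAddCommGroup X] [NormedSpace ℝ X] where
  T : ℝ≥0 → X →L[ℝ] X
  map_zero : T 0 = ContinuousLinearMap.id ℝ X
  map_add : ∀ s t, T (s + t) = (T s).comp (T t)
  tendsto_zero : ∀ x, Tendsto (fun t => T t x) (𝓝[>] 0) (𝓝 x)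

/-- `A` is the infinitesimal generator of the semigroup `S`: the domain of `A` is the set of all
`x` for which the limit of `(T(t)x - x)/t` as `t ↓ 0` exists, and `A x` is that limit. -/
def C0Semigroup.HasGenerator {X : Type*} [NormedAddCommGroup X] [NormedSpace ℝ X]
    (S : C0Semigroup X) (A : X →ₗ.[ℝ] X) : Prop :=
  ∀ x y : X, (x, y) ∈ A.graph ↔
    Tendsto (fun t : ℝ≥0 => (t : ℝ)⁻¹ • (S.T t x - x)) (𝓝[>] 0) (𝓝 y)

end PiezoActuator

end

/-! The operator `op p` is skew-symmetric for the energy inner product and maps its domain onto the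
whole state space. On a real Hilbert space these two facts already give a contraction semigroup
(`exists_c0Semigroup_of_skewSymmetric_of_surjective`).

The abstract half works with the inverse. Skewness and surjectivity make the operator injective, and
its inverse `R` is bounded by the closed graph theorem, skew-adjoint, and has dense range. With `N =
(R - ε)⁻¹`, the skew part `B` of `N` is a bounded skew-adjoint substitute for `R⁻¹`
(`exists_approx_inverse`). The orthogonal groups `exp (t • B)` converge strongly as `ε → 0`, and
estimates uniform in `ε` identify the generator of the limit as `R⁻¹`
(`exists_c0Semigroup_of_skewAdjoint_inverse`).

The concrete half has three ingredients. Completing squares identifies the energy space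
isometrically with `L²(0,1)⁶`, hence it is complete. The stiffness matrix is nonsingular, so the
three boundary conditions say exactly that each `xᵢ'(1) = 0`; integration by parts then has no
boundary terms, and `op_skewSymmetric` follows. Finally `coeff p` is invertible, so `op p x = f` is
solved by integrating twice (`op_surjective`). -/

namespace PiezoActuator

/-! ### Groups generated by skew-adjoint operators -/

section SkewAdjoint

open NormedSpace ContinuousLinearMap

variable {X : Type*} [NormedAddCommGroup X]

/-- A pointwise Cauchy condition on a dense set extends to the whole space, for
nonexpansive maps. -/
lemma cauchySeq_of_denseRange {Z : Type*} {j : Z → X} (hj : DenseRange j) {F : ℕ → X → X}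
    (hF : ∀ n x y, ‖F n x - F n y‖ ≤ ‖x - y‖) (h : ∀ z, CauchySeq fun n => F n (j z)) (x : X) :
    CauchySeq fun n => F n x := by
  rw [Metric.cauchySeq_iff]
  intro ε hε
  obtain ⟨z, hz⟩ := hj.exists_dist_lt x (show 0 < ε / 3 by positivity)
  obtain ⟨N, hN⟩ := Metric.cauchySeq_iff.mp (h z) (ε / 3) (by positivity)
  refine ⟨N, fun m hm n hn => ?_⟩
  have h1 := hF m x (j z)
  have h2 := hF n (j z) x
  have h3 := hN m hm n hn
  rw [← dist_eq_norm, ← dist_eq_norm] at h1 h2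
  rw [dist_comm (j z) x] at h2
  have h4 := dist_triangle4 (F m x) (F m (j z)) (F n (j z)) (F n x)
  linarith

/-- A uniform Lipschitz bound transfers convergence from a dense set. It serves both for strong
continuity and for difference quotients composed with the inverse of the generator. -/
lemma tendsto_id_of_denseRange {ι Z : Type*} {l : Filter ι} {j : Z → X} (hj : DenseRange j)
    {F : ι → X → X} {C : ℝ} (hC : 0 ≤ C) (hF : ∀ᶠ i in l, ∀ x y, ‖F i x - F i y‖ ≤ C * ‖x - y‖)
    (h : ∀ z, Tendsto (fun i => F i (j z)) l (𝓝 (j z))) (x : X) :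
    Tendsto (fun i => F i x) l (𝓝 x) := by
  rw [Metric.tendsto_nhds]
  intro ε hε
  obtain ⟨z, hz⟩ := hj.exists_dist_lt x (show 0 < ε / (2 * (C + 1)) by positivity)
  filter_upwards [hF, Metric.tendsto_nhds.mp (h z) (ε / 2) (by positivity)] with i h1 h2
  have h3 := h1 x (j z)
  rw [← dist_eq_norm, ← dist_eq_norm] at h3
  have h4 := dist_triangle4 (F i x) (F i (j z)) (j z) x
  rw [dist_comm (j z) x] at h4
  have h5 : (C + 1) * dist x (j z) < ε / 2 := by
    rw [lt_div_iff₀ (by positivity)] at hz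
    linarith
  linarith

variable [InnerProductSpace ℝ X] [CompleteSpace X]

/-- The exponential of a skew-adjoint operator is unitary. -/
lemma norm_exp_apply_le {B : X →L[ℝ] X} (hB : star B = -B) (t : ℝ) (x : X) :
    ‖exp (t • B) x‖ ≤ ‖x‖ := by
  let +nondep : NormedAlgebra ℚ (X →L[ℝ] X) := .restrictScalars ℚ ℝ _
  have hmem : t • B ∈ skewAdjoint (X →L[ℝ] X) := by
    rw [skewAdjoint.mem_iff, star_smul, hB, star_trivial, smul_neg]
  have hu := exp_mem_unitary_of_mem_skewAdjoint hmem
  -- A unitary element has norm one only in a nontrivial algebra.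
  rcases subsingleton_or_nontrivial X with h | h
  · simp [Subsingleton.elim x 0]
  · have := (exp (t • B)).le_opNorm x
    rwa [CStarRing.norm_of_mem_unitary hu, one_mul] at this

/-- Mean value inequality for `s ↦ exp (s • B) x - s • y`, whose derivative is `exp (s • B) (B x) -
y`. -/
lemma norm_exp_apply_sub_sub_le {B : X →L[ℝ] X} {x y : X} {t C : ℝ}
    (ht : 0 ≤ t) (h : ∀ s ∈ Ico 0 t, ‖exp (s • B) (B x) - y‖ ≤ C) :
    ‖exp (t • B) x - x - t • y‖ ≤ C * t := by
  have hd : ∀ s : ℝ, HasDerivAt (fun s : ℝ => exp (s • B) x - s • y)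
      (exp (s • B) (B x) - y) s := by
    intro s
    have h1 := (hasDerivAt_exp_smul_const (𝕂 := ℝ) B s).clm_apply (hasDerivAt_const s x)
    have h2 := (hasDerivAt_id s).smul_const y
    convert! h1.sub h2 using 1
    simp
  have := norm_image_sub_le_of_norm_deriv_le_segment' (a := 0) (b := t)
    (fun s _ => (hd s).hasDerivWithinAt) h t ⟨ht, le_refl t⟩
  simpa [sub_right_comm] using this

lemma norm_exp_apply_sub_le {B : X →L[ℝ] X} (hB : star B = -B) (x : X) {t : ℝ} (ht : 0 ≤ t) :
    ‖exp (t • B) x - x‖ ≤ ‖B x‖ * t := by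
  simpa using norm_exp_apply_sub_sub_le (B := B) (x := x) (y := 0) ht
    fun s _ => by simpa using norm_exp_apply_le hB s (B x)

/-- Commutation allows `exp (t • B) = exp (t • D) * exp (t • (B - D))`. The first factor is
nonexpansive, so only the group of the skew-adjoint operator `B - D` has to be compared with the
identity. -/
lemma norm_exp_apply_sub_exp_apply_le {B D : X →L[ℝ] X} (hB : star B = -B) (hD : star D = -D)
    (h : Commute B D) (x : X) {t : ℝ} (ht : 0 ≤ t) :
    ‖exp (t • B) x - exp (t • D) x‖ ≤ ‖B x - D x‖ * t := by
  let +nondep : NormedAlgebra ℚ (X →L[ℝ] X) := .restrictScalars ℚ ℝ _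
  have hBD : star (B - D) = -(B - D) := by rw [star_sub, hB, hD]; abel
  have e : exp (t • B) = exp (t • D) * exp (t • (B - D)) := by
    rw [← exp_add_of_commute, smul_sub, add_sub_cancel]
    exact ((h.symm.sub_right (Commute.refl D)).smul_left t).smul_right t
  rw [e, mul_apply_eq_comp, ← map_sub]
  exact (norm_exp_apply_le hD t _).trans (norm_exp_apply_sub_le hBD x ht)

/-- A bounded skew-adjoint approximation of the inverse of a skew-adjoint operator. -/
lemma exists_approx_inverse {R : X →L[ℝ] X} (hR : star R = -R) {ε : ℝ} (hε : 0 < ε) :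
    ∃ B : X →L[ℝ] X, star B = -B ∧ (∀ S, Commute S R → Commute S B) ∧
      (∀ y, ‖B (R y)‖ ≤ 2 * ‖y‖) ∧ ∀ z, ‖B (R (R z)) - R z‖ ≤ ε * ‖z‖ := by
  have hskew : ∀ x, inner ℝ (R x) x = 0 := by
    intro x
    have h1 : inner ℝ ((star R) x) x = inner ℝ x (R x) := adjoint_inner_left R x x
    rw [hR, neg_apply, inner_neg_left, real_inner_comm] at h1
    rw [real_inner_comm]
    linarith
  set T : X →L[ℝ] X := R - ε • 1 with hT
  have hin : ∀ x, inner ℝ (T x) x = -(ε * ‖x‖ ^ 2) := by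
    intro x
    simp [hT, inner_sub_left, hskew, real_inner_smul_left]
  have hunit : IsUnit T := by
    -- Skewness removes `R` from the quadratic form of `T`, leaving `-ε‖x‖²`; this coercivity makes
    -- `T` invertible.
    refine isUnit_of_forall_le_norm_inner_map T (c := ⟨ε, hε.le⟩) hε fun x => ?_
    rw [hin, norm_neg, Real.norm_of_nonneg (by positivity)]
    exact (mul_comm _ _).le
  obtain ⟨u, hu⟩ := hunit
  set N : X →L[ℝ] X := ↑u⁻¹ with hN
  have hTN : T * N = 1 := by rw [← hu]; exact u.mul_inv
  have hNT : N * T = 1 := by rw [← hu]; exact u.inv_mul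
  have hNR : N * R = 1 + ε • N := by
    rw [hT, mul_sub, mul_smul_comm, mul_one] at hNT
    rw [← hNT, sub_add_cancel]
  have hsNR : star N * R = -(1 + ε • star N) := by
    have : star (T * N) = 1 := by rw [hTN, star_one]
    have hRN : R * N = 1 + ε • N := by
      rw [hT, sub_mul, smul_mul_assoc, one_mul] at hTN
      rw [← hTN, sub_add_cancel]
    have h2 := congrArg star hRN
    rw [star_mul, hR, star_add, star_one, star_smul, star_trivial ε, mul_neg] at h2
    rw [← h2, neg_neg]
  -- The form identity at `N x` reads `⟪x, N x⟫ = -ε‖N x‖²`; Cauchy–Schwarz then gives `ε‖N x‖ ≤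
  -- ‖x‖`.
  have hnorm : ‖ε • N‖ ≤ 1 := by
    refine opNorm_le_bound _ zero_le_one fun x => ?_
    have h1 := hin (N x)
    have h2 : T (N x) = x := by
      rw [← mul_apply_eq_comp, hTN, one_apply_eq_self]
    rw [h2] at h1
    have h3 := abs_real_inner_le_norm x (N x)
    rw [h1, abs_neg, abs_of_nonneg (by positivity)] at h3
    rw [smul_apply, norm_smul, Real.norm_of_nonneg hε.le, one_mul]
    rcases (norm_nonneg (N x)).eq_or_lt with h4 | h4
    · rw [← h4, mul_zero]
      exact norm_nonneg x
    · refine le_of_mul_le_mul_right ?_ h4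
      linarith
  have hnorm' : ‖ε • star N‖ ≤ 1 := by
    have : ε • star N = star (ε • N) := by rw [star_smul, star_trivial ε]
    rw [this, star_eq_adjoint, LinearIsometryEquiv.norm_map]
    exact hnorm
  have hn1 : ∀ y, ‖(ε • N) y‖ ≤ ‖y‖ := fun y => by simpa using le_of_opNorm_le _ hnorm y
  have hn2 : ∀ y, ‖(ε • star N) y‖ ≤ ‖y‖ := fun y => by simpa using le_of_opNorm_le _ hnorm' y
  have hcomm : ∀ S, Commute S R → Commute S T := fun S h =>
    h.sub_right ((Commute.one_right S).smul_right ε)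
  have hcomm' : ∀ S, Commute S R → Commute S (star T) := fun S h => by
    rw [hT, star_sub, star_smul, star_one, hR, star_trivial ε]
    exact h.neg_right.sub_right ((Commute.one_right S).smul_right ε)
  -- The skew part of the resolvent. On a spectral value `iλ` of `R` it acts as `-iλ / (λ² + ε²)`, a
  -- regularization of `1 / (iλ)`.
  set B : X →L[ℝ] X := (1 / 2 : ℝ) • (N - star N) with hB
  have hBR : B * R = 1 + (1 / 2 : ℝ) • (ε • N + ε • star N) := by
    rw [hB, smul_mul_assoc, sub_mul, hNR, hsNR]
    module
  -- The second factor `R` turns the bounded remainder of `B * R - 1` into one of order `ε`: in `(N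
  -- + star N) * R` the identity terms cancel.
  have hBRR : B * R * R - R = (ε / 2) • (ε • N - ε • star N) := by
    have e1 : (ε • N + ε • star N) * R = ε • (ε • N - ε • star N) := by
      rw [add_mul, smul_mul_assoc, smul_mul_assoc, hNR, hsNR]
      module
    rw [hBR, add_mul, one_mul, add_sub_cancel_left, smul_mul_assoc, e1]
    module
  refine ⟨B, ?_, fun S hS => ?_, fun y => ?_, fun z => ?_⟩
  · rw [hB, star_smul, star_sub, star_star, star_trivial (1 / 2 : ℝ)]
    module
  · refine (Commute.sub_right ?_ ?_).smul_right _
    · have h1 := hcomm S hS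
      rw [← hu] at h1
      exact h1.units_inv_right
    · have h1 := hcomm' S hS
      rw [← hu, ← Units.coe_star] at h1
      have h2 := h1.units_inv_right
      rwa [Units.coe_star_inv] at h2
  · have e : B (R y) = y + (1 / 2 : ℝ) • ((ε • N) y + (ε • star N) y) := by
      have := congrArg (fun L : X →L[ℝ] X => L y) hBR
      simpa using this
    rw [e]
    have h1 := norm_add_le ((ε • N) y) ((ε • star N) y)
    have h2 := norm_add_le y ((1 / 2 : ℝ) • ((ε • N) y + (ε • star N) y))
    rw [norm_smul, Real.norm_of_nonneg (by norm_num)] at h2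
    have h3 := hn1 y
    have h4 := hn2 y
    linarith
  · have e : B (R (R z)) - R z = (ε / 2) • ((ε • N) z - (ε • star N) z) := by
      have := congrArg (fun L : X →L[ℝ] X => L z) hBRR
      simpa using this
    rw [e, norm_smul, Real.norm_of_nonneg (by positivity)]
    have h1 := norm_sub_le ((ε • N) z) ((ε • star N) z)
    have h3 := hn1 z
    have h4 := hn2 z
    nlinarith

/-- A skew-adjoint operator with bounded inverse `R` generates a contraction semigroup. -/
theorem exists_c0Semigroup_of_skewAdjoint_inverse {R : X →L[ℝ] X} (hR : star R = -R)
    (hinj : Function.Injective R) :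
    ∃ S : C0Semigroup X, (∀ t, ‖S.T t‖ ≤ 1) ∧ ∀ x y, x = R y ↔
      Tendsto (fun t : ℝ≥0 => (t : ℝ)⁻¹ • (S.T t x - x)) (𝓝[>] 0) (𝓝 y) := by
  let +nondep : NormedAlgebra ℚ (X →L[ℝ] X) := .restrictScalars ℚ ℝ _
  -- The orthogonal complement of the range is the kernel of `star R = -R`, which is trivial.
  have hdense : DenseRange R := by
    have h1 := orthogonal_range R
    rw [← star_eq_adjoint, hR] at h1
    have h2 : (-R).ker = ⊥ := by
      rw [LinearMap.ker_eq_bot]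
      exact fun a b hab => hinj (neg_injective hab)
    rw [h2] at h1
    have h3 := (Submodule.topologicalClosure_eq_top_iff (K := R.range)).mpr h1
    exact Submodule.dense_iff_topologicalClosure_eq_top.mpr h3
  have hdense2 : DenseRange fun z => R (R z) := hdense.comp hdense R.continuous
  choose B hskew hcomm hbd happ using fun n : ℕ =>
    exists_approx_inverse hR (ε := 1 / ((n : ℝ) + 1)) (by positivity)
  have hBR : ∀ n, Commute R (B n) := fun n => hcomm n R (Commute.refl R)
  have hBB : ∀ m n, Commute (B m) (B n) := fun m n => hcomm n (B m) (hBR m).symm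
  have hε : Tendsto (fun n : ℕ => 1 / ((n : ℝ) + 1)) atTop (𝓝 0) :=
    tendsto_one_div_add_atTop_nhds_zero_nat
  -- On the dense range of `R²` the vectors `B n (R (R z))` converge to `R z` at rate `1 / (n + 1)`,
  -- and the commuting-exponentials estimate carries this rate over to the groups.
  have hcauchy : ∀ (t : ℝ≥0) x, CauchySeq fun n => exp ((t : ℝ) • B n) x := by
    intro t
    refine cauchySeq_of_denseRange hdense2 (fun n x y => ?_) fun z => ?_
    · rw [← map_sub]
      exact norm_exp_apply_le (hskew n) _ _
    · refine cauchySeq_of_le_tendsto_0 (fun n : ℕ => 2 * (1 / ((n : ℝ) + 1)) * ‖z‖ * t)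
        (fun n m k hn hm => ?_) ?_
      · rw [dist_eq_norm]
        refine (norm_exp_apply_sub_exp_apply_le (hskew n) (hskew m) (hBB n m) _ t.2).trans ?_
        refine mul_le_mul_of_nonneg_right ?_ t.2
        have h1 := happ n z
        have h2 := happ m z
        have h3 : B n (R (R z)) - B m (R (R z))
          = (B n (R (R z)) - R z) - (B m (R (R z)) - R z) := by abel
        have h4 := norm_sub_le (B n (R (R z)) - R z) (B m (R (R z)) - R z)
        have h5 : 1 / ((n : ℝ) + 1) ≤ 1 / ((k : ℝ) + 1) :=
          one_div_le_one_div_of_le (by positivity) (by gcongr)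
        have h6 : 1 / ((m : ℝ) + 1) ≤ 1 / ((k : ℝ) + 1) :=
          one_div_le_one_div_of_le (by positivity) (by gcongr)
        rw [h3]
        nlinarith [mul_le_mul_of_nonneg_right h5 (norm_nonneg z),
          mul_le_mul_of_nonneg_right h6 (norm_nonneg z)]
      · simpa using ((hε.const_mul 2).mul_const ‖z‖).mul_const (t : ℝ)
  choose f hf using fun t x => cauchySeq_tendsto_of_complete (hcauchy t x)
  let T : ℝ≥0 → X →L[ℝ] X := fun t =>
    continuousLinearMapOfTendsto (fun n => exp ((t : ℝ) • B n)) (tendsto_pi_nhds.mpr (hf t))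
  have hT : ∀ (t : ℝ≥0) x, Tendsto (fun n => exp ((t : ℝ) • B n) x) atTop (𝓝 (T t x)) := hf
  have hTle : ∀ t x, ‖T t x‖ ≤ ‖x‖ := fun t x =>
    le_of_tendsto (hT t x).norm (Eventually.of_forall fun n => norm_exp_apply_le (hskew n) _ _)
  have hTR : ∀ t x, T t (R x) = R (T t x) := by
    intro t x
    refine tendsto_nhds_unique (hT t (R x)) ?_
    refine ((R.continuous.tendsto _).comp (hT t x)).congr fun n => ?_
    have : Commute R (exp ((t : ℝ) • B n)) := ((hBR n).smul_right _).exp_right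
    exact congrArg (fun L : X →L[ℝ] X => L x) this.eq
  have hT1 : ∀ (t : ℝ≥0) y, ‖T t (R y) - R y‖ ≤ 2 * ‖y‖ * t := fun t y =>
    le_of_tendsto ((hT t (R y)).sub_const _).norm (Eventually.of_forall fun n =>
      (norm_exp_apply_sub_le (hskew n) _ t.2).trans
        (mul_le_mul_of_nonneg_right (hbd n y) t.2))
  -- A Taylor bound uniform in `n`: the derivative differs from `R z` by the approximation error,
  -- which vanishes in the limit, plus the displacement of `R z`, which is at most `2 * ‖z‖ * t`.
  have hT2 : ∀ (t : ℝ≥0) z, ‖T t (R (R z)) - R (R z) - (t : ℝ) • R z‖ ≤ 2 * ‖z‖ * t * t := by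
    intro t z
    have hlim : Tendsto (fun n : ℕ => (1 / ((n : ℝ) + 1) * ‖z‖ + 2 * ‖z‖ * t) * t) atTop
        (𝓝 (2 * ‖z‖ * t * t)) := by
      simpa using ((hε.mul_const ‖z‖).add_const (2 * ‖z‖ * t)).mul_const (t : ℝ)
    refine le_of_tendsto_of_tendsto (((hT t _).sub_const _).sub_const _).norm hlim
      (Eventually.of_forall fun n => norm_exp_apply_sub_sub_le t.2 fun s hs => ?_)
    have e : exp (s • B n) (B n (R (R z))) - R z
        = exp (s • B n) (B n (R (R z)) - R z) + (exp (s • B n) (R z) - R z) := by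
      rw [map_sub]
      abel
    rw [e]
    refine (norm_add_le _ _).trans (add_le_add ?_ ?_)
    · exact (norm_exp_apply_le (hskew n) _ _).trans (happ n z)
    · refine (norm_exp_apply_sub_le (hskew n) _ hs.1).trans ?_
      exact mul_le_mul (hbd n z) hs.2.le hs.1 (by positivity)
  have hcoe : Tendsto (fun t : ℝ≥0 => (t : ℝ)) (𝓝[>] 0) (𝓝 0) :=
    (NNReal.continuous_coe.tendsto' 0 0 rfl).mono_left nhdsWithin_le_nhds
  have hpos : ∀ᶠ t : ℝ≥0 in 𝓝[>] 0, 0 < (t : ℝ) := by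
    filter_upwards [self_mem_nhdsWithin] with t ht
    exact ht
  -- By `hT1` the quotients, as maps of `y`, are Lipschitz with constant 2 for every `t > 0`. So it
  -- suffices to take `y = R z`, where `hT2` leaves an error of order `t`.
  have hgen : ∀ y, Tendsto (fun t : ℝ≥0 => (t : ℝ)⁻¹ • (T t (R y) - R y)) (𝓝[>] 0) (𝓝 y) := by
    refine tendsto_id_of_denseRange hdense (C := 2) (by norm_num) ?_ fun z => ?_
    · filter_upwards [hpos] with t ht x y
      have e : (t : ℝ)⁻¹ • (T t (R x) - R x) - (t : ℝ)⁻¹ • (T t (R y) - R y)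
          = (t : ℝ)⁻¹ • (T t (R (x - y)) - R (x - y)) := by
        simp only [map_sub]
        module
      rw [e, norm_smul, norm_inv, Real.norm_of_nonneg ht.le, inv_mul_le_iff₀ ht]
      exact (hT1 t (x - y)).trans_eq (mul_comm _ _)
    · rw [tendsto_iff_norm_sub_tendsto_zero]
      refine squeeze_zero' (Eventually.of_forall fun _ => norm_nonneg _) ?_
        (g := fun t : ℝ≥0 => 2 * ‖z‖ * t) (by simpa using hcoe.const_mul (2 * ‖z‖))
      filter_upwards [hpos] with t ht
      have e : (t : ℝ)⁻¹ • (T t (R (R z)) - R (R z)) - R z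
          = (t : ℝ)⁻¹ • (T t (R (R z)) - R (R z) - (t : ℝ) • R z) := by
        rw [smul_sub _ _ ((t : ℝ) • R z), smul_smul, inv_mul_cancel₀ ht.ne', one_smul]
      rw [e, norm_smul, norm_inv, Real.norm_of_nonneg ht.le, inv_mul_le_iff₀ ht]
      exact (hT2 t z).trans_eq (mul_comm _ _)
  refine ⟨⟨T, ?_, fun s t => ?_, fun x => ?_⟩,
    fun t => ContinuousLinearMap.opNorm_le_bound _ zero_le_one fun x => ?_, fun x y => ⟨?_, ?_⟩⟩
  · ext x
    exact tendsto_nhds_unique (hT 0 x) (by simp)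
  · ext x
    refine tendsto_nhds_unique (hT (s + t) x) ?_
    have h1 : Tendsto (fun n => exp ((s : ℝ) • B n) (exp ((t : ℝ) • B n) x - T t x)) atTop
        (𝓝 0) := by
      refine squeeze_zero_norm (fun n => norm_exp_apply_le (hskew n) _ _) ?_
      simpa using ((hT t x).sub_const (T t x)).norm
    have h2 := h1.add (hT s (T t x))
    rw [zero_add] at h2
    refine h2.congr fun n => ?_
    rw [map_sub, sub_add_cancel, NNReal.coe_add, add_smul, exp_add_of_commute]
    · rfl
    · exact ((Commute.refl (B n)).smul_left _).smul_right _
  · refine tendsto_id_of_denseRange hdense (C := 1) zero_le_one ?_ (fun z => ?_) x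
    · refine Eventually.of_forall fun t x y => ?_
      rw [← map_sub, one_mul]
      exact hTle t _
    · rw [tendsto_iff_norm_sub_tendsto_zero]
      exact squeeze_zero (fun _ => norm_nonneg _) (fun t => hT1 t z)
        (by simpa using hcoe.const_mul (2 * ‖z‖))
  · rw [one_mul]
    exact hTle t x
  · rintro rfl
    exact hgen y
  -- The generator is no larger than `R⁻¹`: applying `R` to the quotients at `x` gives those at `R
  -- x`, which tend to `R y` by assumption and to `x` by `hgen`.
  · intro h
    have h1 := (R.continuous.tendsto _).comp h
    refine tendsto_nhds_unique ((hgen x).congr fun t => ?_) h1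
    change _ = R ((t : ℝ)⁻¹ • (T t x - x))
    rw [map_smul, map_sub, hTR]

/-- A surjective skew-symmetric operator on a real Hilbert space generates a contraction
semigroup. -/
theorem exists_c0Semigroup_of_skewSymmetric_of_surjective {A : X →ₗ.[ℝ] X}
    (hA : ∀ x y : A.domain, inner ℝ (A x) (y : X) = -inner ℝ (x : X) (A y))
    (hsurj : Function.Surjective A) :
    ∃ S : C0Semigroup X, S.HasGenerator A ∧ ∀ t, ‖S.T t‖ ≤ 1 := by
  -- Choosing `y` with `A y = x` turns skewness into `0 = -‖x‖²`.
  have hker : ∀ x : A.domain, A x = 0 → x = 0 := by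
    intro x hx
    obtain ⟨y, hy⟩ := hsurj (x : X)
    have h := hA x y
    rw [hx, hy, inner_zero_left, zero_eq_neg, inner_self_eq_zero] at h
    exact Subtype.ext h
  have hAinj : Function.Injective A.toFun := by
    rw [← LinearMap.ker_eq_bot, LinearMap.ker_eq_bot']
    exact hker
  let e : A.domain ≃ₗ[ℝ] X := LinearEquiv.ofBijective A.toFun ⟨hAinj, hsurj⟩
  have he : ∀ y, A (e.symm y) = y := fun y => e.apply_symm_apply y
  let R₀ : X →ₗ[ℝ] X := A.domain.subtype ∘ₗ e.symm.toLinearMap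
  have hR₀ : ∀ x y, inner ℝ (R₀ x) y = -inner ℝ x (R₀ y) := by
    intro x y
    have h := hA (e.symm x) (e.symm y)
    rw [he, he] at h
    change inner ℝ (e.symm x : X) y = -inner ℝ x (e.symm y : X)
    rw [h, neg_neg]
  -- Hellinger–Toeplitz: an everywhere defined skew-symmetric map has closed graph.
  have hcont : Continuous R₀ := by
    refine R₀.continuous_of_seq_closed_graph fun u x y hu hTu => ?_
    refine ext_inner_right ℝ fun v => ?_
    rw [hR₀]
    refine tendsto_nhds_unique (hTu.inner tendsto_const_nhds) ?_
    simp only [Function.comp_apply, hR₀]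
    exact (hu.inner tendsto_const_nhds).neg
  let R : X →L[ℝ] X := ⟨R₀, hcont⟩
  have hstar : star R = -R := by
    rw [star_eq_adjoint, eq_comm, eq_adjoint_iff]
    intro x y
    change inner ℝ (-R₀ x) y = inner ℝ x (R₀ y)
    rw [inner_neg_left, hR₀, neg_neg]
  have hRinj : Function.Injective R := Subtype.val_injective.comp e.symm.injective
  obtain ⟨S, hS, hgen⟩ := exists_c0Semigroup_of_skewAdjoint_inverse hstar hRinj
  refine ⟨S, fun x y => ?_, hS⟩
  rw [← hgen, LinearPMap.mem_graph_iff]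
  constructor
  · rintro ⟨z, rfl, rfl⟩
    change (z : X) = (e.symm (e z) : X)
    rw [e.symm_apply_apply]
  · rintro rfl
    exact ⟨e.symm y, rfl, he y⟩

end SkewAdjoint

/-! ### Primitives of square-integrable functions -/

lemma L2.integrable_indicator (g : L2) : Integrable ((Ioo (0 : ℝ) 1).indicator g) := by
  rw [integrable_indicator_iff measurableSet_Ioo]
  exact (Lp.memLp g).integrable (by norm_num)

/-- The primitive of `g` taking the value `c` at `0`. -/
noncomputable def primitive (g : L2) (c z : ℝ) : ℝ :=
  c + ∫ t in (0 : ℝ)..z, (Ioo (0 : ℝ) 1).indicator g t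

lemma primitive_zero (g : L2) (c : ℝ) : primitive g c 0 = c := by
  simp [primitive]

lemma continuous_primitive (g : L2) (c : ℝ) : Continuous (primitive g c) :=
  continuous_const.add
    (intervalIntegral.continuous_primitive (fun _ _ => g.integrable_indicator.intervalIntegrable) 0)

lemma absolutelyContinuous_primitive (g : L2) (c : ℝ) :
    AbsolutelyContinuousOnInterval (primitive g c) 0 1 := by
  have h1 : AbsolutelyContinuousOnInterval (fun _ : ℝ => c) 0 1 :=
    (LipschitzWith.const c).lipschitzOnWith.absolutelyContinuousOnInterval
  have h2 := (g.integrable_indicator.intervalIntegrable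
    (a := 0) (b := 1)).absolutelyContinuousOnInterval_intervalIntegral (c := 0) (by simp)
  exact h1.add h2

lemma deriv_primitive_ae (g : L2) (c : ℝ) :
    deriv (primitive g c) =ᵐ[(volume : Measure ℝ).restrict (Ioo 0 1)] g := by
  filter_upwards [ae_restrict_of_ae
      (LocallyIntegrable.ae_hasDerivAt_integral g.integrable_indicator.locallyIntegrable),
    ae_restrict_mem measurableSet_Ioo] with z h1 h2
  have h3 := ((h1 0).const_add c).deriv
  rw [indicator_of_mem h2] at h3
  exact h3

lemma memLp_primitive (g : L2) (c : ℝ) :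
    MemLp (primitive g c) 2 ((volume : Measure ℝ).restrict (Ioo 0 1)) := by
  obtain ⟨M, hM⟩ := isCompact_Icc.exists_bound_of_continuousOn
    (continuous_primitive g c).continuousOn (s := Icc (0 : ℝ) 1)
  refine MemLp.of_bound (continuous_primitive g c).aestronglyMeasurable M ?_
  filter_upwards [ae_restrict_mem measurableSet_Ioo] with z hz
  exact hM z (Ioo_subset_Icc_self hz)

/-- The primitive of `g` taking the value `c` at `0`, as an element of `L²(0,1)`. -/
noncomputable def primitiveLp (g : L2) (c : ℝ) : L2 := (memLp_primitive g c).toLp _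

lemma coeFn_primitiveLp (g : L2) (c : ℝ) :
    (primitiveLp g c : ℝ → ℝ) =ᵐ[(volume : Measure ℝ).restrict (Ioo 0 1)] primitive g c :=
  (memLp_primitive g c).coeFn_toLp

/-- Integration by parts for absolutely continuous functions. Only the products need vanish at the
endpoints, so `K` can be a test function or a primitive vanishing just at `0`. -/
lemma integral_primitive_mul_deriv (g : L2) (c : ℝ) {K : ℝ → ℝ}
    (hK : AbsolutelyContinuousOnInterval K 0 1) (h0 : primitive g c 0 * K 0 = 0)
    (h1 : primitive g c 1 * K 1 = 0) :
    ∫ z in Ioo (0 : ℝ) 1, primitive g c z * deriv K z = -∫ z in Ioo (0 : ℝ) 1, g z * K z := by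
  have h := (absolutelyContinuous_primitive g c).integral_mul_deriv_eq_deriv_mul hK
  rw [h0, h1, sub_zero, zero_sub, intervalIntegral.integral_of_le zero_le_one,
    intervalIntegral.integral_of_le zero_le_one, integral_Ioc_eq_integral_Ioo,
    integral_Ioc_eq_integral_Ioo] at h
  rw [h]
  refine congrArg _ (integral_congr_ae ?_)
  filter_upwards [deriv_primitive_ae g c] with z hz
  rw [hz]

lemma hasWeakDeriv_primitiveLp (g : L2) (c : ℝ) : HasWeakDeriv (primitiveLp g c) g := by
  intro φ hφ
  obtain ⟨L, hL⟩ := ContDiff.lipschitzWith_of_hasCompactSupport hφ.2.1 hφ.1 (by simp)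
  have hz : ∀ z, z ∉ Ioo (0 : ℝ) 1 → φ z = 0 := fun z hz =>
    image_eq_zero_of_notMem_tsupport fun h => hz (hφ.2.2 h)
  rw [← integral_primitive_mul_deriv g c hL.lipschitzOnWith.absolutelyContinuousOnInterval
    (by rw [hz 0 (by simp), mul_zero]) (by rw [hz 1 (by simp), mul_zero])]
  refine integral_congr_ae ?_
  filter_upwards [coeFn_primitiveLp g c] with z hz
  rw [hz]

lemma hasBoundaryValue_primitiveLp (g : L2) (c a : ℝ) :
    HasBoundaryValue (primitiveLp g c) a (primitive g c a) :=
  ⟨primitive g c, (continuous_primitive g c).continuousOn, coeFn_primitiveLp g c, rfl⟩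

lemma weakDeriv_primitiveLp (g : L2) (c : ℝ) : weakDeriv (primitiveLp g c) = g :=
  (hasWeakDeriv_primitiveLp g c).weakDeriv_eq

lemma primitiveLp_mem_H10 (g : L2) : primitiveLp g 0 ∈ H10 := by
  refine ⟨⟨g, hasWeakDeriv_primitiveLp g 0⟩, ?_⟩
  simpa [primitive_zero] using hasBoundaryValue_primitiveLp g 0 0

/-- The difference of the two sides lies in `H10` and has zero weak derivative. -/
lemma eq_primitiveLp {f : L2} {c : ℝ} (hf : f ∈ H1) (h : HasBoundaryValue f 0 c) :
    f = primitiveLp (weakDeriv f) c := by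
  have hw := (hasWeakDeriv_weakDeriv hf).add
    ((hasWeakDeriv_primitiveLp (weakDeriv f) c).smul (-1))
  have hb := h.add ((hasBoundaryValue_primitiveLp (weakDeriv f) c 0).smul (-1))
  have h0 := eq_zero_of_weakDeriv_eq_zero
    ⟨⟨_, hw⟩, by simpa [primitive_zero] using hb⟩ (hw.weakDeriv_eq.trans (by simp))
  rw [neg_one_smul, ← sub_eq_add_neg] at h0
  exact sub_eq_zero.mp h0

lemma HasBoundaryValue.unique {f : L2} {a c d : ℝ} (ha : a ∈ Icc (0 : ℝ) 1)
    (hc : HasBoundaryValue f a c) (hd : HasBoundaryValue f a d) : c = d := by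
  obtain ⟨F, hF, hfF, rfl⟩ := hc
  obtain ⟨G, hG, hfG, rfl⟩ := hd
  have hon : EqOn F G (Ioo 0 1) := Measure.eqOn_open_of_ae_eq (hfF.symm.trans hfG) isOpen_Ioo
    (hF.mono Ioo_subset_Icc_self) (hG.mono Ioo_subset_Icc_self)
  exact hon.of_subset_closure hF hG Ioo_subset_Icc_self
    (by rw [closure_Ioo (zero_ne_one' ℝ)]) ha

/-- Integration by parts for Sobolev functions. -/
lemma inner_weakDeriv_left {w v : L2} (hw : w ∈ H1) (hw1 : HasBoundaryValue w 1 0)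
    (hv : v ∈ H10) : inner ℝ (weakDeriv w) v = -inner ℝ w (weakDeriv v) := by
  -- The continuous representative supplies the unknown value of `w` at `0`; `id` keeps `hw1` for
  -- later use.
  obtain ⟨F, hF, hwF, hF1⟩ := id hw1
  set c := F 0 with hc
  have ew : w = primitiveLp (weakDeriv w) c := eq_primitiveLp hw ⟨F, hF, hwF, rfl⟩
  have ev : v = primitiveLp (weakDeriv v) 0 := eq_primitiveLp hv.1 hv.2
  have h1 : primitive (weakDeriv w) c 1 = 0 := by
    have hb := hasBoundaryValue_primitiveLp (weakDeriv w) c 1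
    rw [← ew] at hb
    exact hb.unique (right_mem_Icc.mpr zero_le_one) hw1
  have key := integral_primitive_mul_deriv (weakDeriv w) c
    (absolutelyContinuous_primitive (weakDeriv v) 0) (by rw [primitive_zero _ 0, mul_zero])
    (by rw [h1, zero_mul])
  have e1 : inner ℝ w (weakDeriv v) = ∫ z in Ioo (0 : ℝ) 1,
      primitive (weakDeriv w) c z * deriv (primitive (weakDeriv v) 0) z := by
    rw [L2.inner_eq]
    refine integral_congr_ae ?_
    have h2 := coeFn_primitiveLp (weakDeriv w) c
    rw [← ew] at h2
    filter_upwards [h2, deriv_primitive_ae (weakDeriv v) 0] with z h3 h4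
    rw [h3, h4]
  have e2 : inner ℝ (weakDeriv w) v = ∫ z in Ioo (0 : ℝ) 1,
      weakDeriv w z * primitive (weakDeriv v) 0 z := by
    rw [L2.inner_eq]
    refine integral_congr_ae ?_
    have h2 := coeFn_primitiveLp (weakDeriv v) 0
    rw [← ev] at h2
    filter_upwards [h2] with z h3
    rw [h3]
  rw [e1, e2, key, neg_neg]

lemma exists_hasWeakDeriv_boundaryValue_one (g : L2) :
    ∃ w : L2, HasWeakDeriv w g ∧ HasBoundaryValue w 1 0 := by
  refine ⟨primitiveLp g (-∫ t in (0 : ℝ)..1, (Ioo (0 : ℝ) 1).indicator g t),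
    hasWeakDeriv_primitiveLp _ _, ?_⟩
  simpa [primitive] using hasBoundaryValue_primitiveLp g
    (-∫ t in (0 : ℝ)..1, (Ioo (0 : ℝ) 1).indicator g t) 1

/-! ### The state space is complete -/

variable {p : Params}

lemma StateSpace.inner_eq (x y : StateSpace p) : inner ℝ x y = energyInner x y := rfl

/-- The state with prescribed spatial derivatives and velocities. -/
noncomputable def StateSpace.ofDeriv (w v : Fin 3 → L2) : StateSpace p :=
  (fun i => ⟨primitiveLp (w i) 0, primitiveLp_mem_H10 (w i)⟩, v)

lemma StateSpace.D_ofDeriv (w v : Fin 3 → L2) (i : Fin 3) :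
    (StateSpace.ofDeriv w v : StateSpace p).D i = w i :=
  weakDeriv_primitiveLp (w i) 0

lemma StateSpace.ofDeriv_snd (w v : Fin 3 → L2) :
    (StateSpace.ofDeriv w v : StateSpace p).2 = v :=
  rfl

/-- The coordinates in which the energy is a sum of squares. -/
noncomputable def energyCoord (p : Params) : StateSpace p →ₗ[ℝ] PiLp 2 fun _ : Fin 6 => L2 where
  toFun x := WithLp.toLp 2
    ![√(p.C11 * p.A) • (x.D 0 - (p.I₀ / p.A) • x.D 1),
      √(p.β * p.A) • (x.D 2 - p.γ • (x.D 0 - (p.I₀ / p.A) • x.D 1)),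
      √(p.C * ((p.A * p.I - p.I₀ ^ 2) / p.A)) • x.D 1,
      √(p.ρ * p.A) • (x.2 0 - (p.I₀ / p.A) • x.2 1),
      √(p.ρ * ((p.A * p.I - p.I₀ ^ 2) / p.A)) • x.2 1,
      √(p.μ * p.A) • x.2 2]
  map_add' x y := by
    have e : ∀ i, (x + y).2 i = x.2 i + y.2 i := fun _ => rfl
    refine PiLp.ext fun i => ?_
    fin_cases i <;> simp [StateSpace.D_add, e] <;> module
  map_smul' c x := by
    have e : ∀ i, (c • x).2 i = c • x.2 i := fun _ => rfl
    refine PiLp.ext fun i => ?_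
    fin_cases i <;> simp [StateSpace.D_smul, e] <;> module

lemma norm_energyCoord (x : StateSpace p) : ‖energyCoord p x‖ = ‖x‖ := by
  have h1 := p.A_pos
  have h2 := div_pos p.det_pos p.A_pos
  have h3 := p.C_pos
  have h4 := p.C11_pos
  have h5 := p.β_pos
  have h6 := p.ρ_pos
  have h7 := p.μ_pos
  have key : ∀ {c : ℝ} (u : L2), 0 < c → ‖√c • u‖ ^ 2 = c * ‖u‖ ^ 2 := fun u hc => by
    rw [norm_smul, mul_pow, Real.norm_of_nonneg (Real.sqrt_nonneg _), Real.sq_sqrt hc.le]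
  rw [← sq_eq_sq₀ (norm_nonneg _) (norm_nonneg _), PiLp.norm_sq_eq_of_L2,
    ← real_inner_self_eq_norm_sq x, StateSpace.inner_eq, energyInner_self, Fin.sum_univ_six,
    ← key _ (mul_pos h4 h1), ← key _ (mul_pos h5 h1), ← key _ (mul_pos h3 h2),
    ← key _ (mul_pos h6 h1), ← key _ (mul_pos h6 h2), ← key _ (mul_pos h7 h1)]
  rfl

lemma surjective_energyCoord : Function.Surjective (energyCoord p) := by
  have h1 := p.A_pos
  have h2 := div_pos p.det_pos p.A_pos
  have c1 := (Real.sqrt_pos.mpr (mul_pos p.C11_pos h1)).ne'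
  have c2 := (Real.sqrt_pos.mpr (mul_pos p.β_pos h1)).ne'
  have c3 := (Real.sqrt_pos.mpr (mul_pos p.C_pos h2)).ne'
  have c4 := (Real.sqrt_pos.mpr (mul_pos p.ρ_pos h1)).ne'
  have c5 := (Real.sqrt_pos.mpr (mul_pos p.ρ_pos h2)).ne'
  have c6 := (Real.sqrt_pos.mpr (mul_pos p.μ_pos h1)).ne'
  intro y
  -- The coordinates are triangular in the derivatives and velocities, so they are inverted by back
  -- substitution.
  let a : L2 := (√(p.C11 * p.A))⁻¹ • y 0
  let b : L2 := (√(p.C * ((p.A * p.I - p.I₀ ^ 2) / p.A)))⁻¹ • y 2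
  let e : L2 := (√(p.ρ * ((p.A * p.I - p.I₀ ^ 2) / p.A)))⁻¹ • y 4
  refine ⟨StateSpace.ofDeriv
    ![a + (p.I₀ / p.A) • b, b, (√(p.β * p.A))⁻¹ • y 1 + p.γ • a]
    ![(√(p.ρ * p.A))⁻¹ • y 3 + (p.I₀ / p.A) • e, e, (√(p.μ * p.A))⁻¹ • y 5], ?_⟩
  refine PiLp.ext fun i => ?_
  fin_cases i <;>
    simp [energyCoord, StateSpace.D_ofDeriv, StateSpace.ofDeriv_snd, a, b, e, smul_smul, c1, c2, c3,
      c4, c5, c6]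

/-- Completeness is pulled back along the surjective linear isometry `energyCoord p`. -/
instance : CompleteSpace (StateSpace p) :=
  ((AddMonoidHomClass.isometry_of_norm (energyCoord p)
    norm_energyCoord).isUniformInducing.completeSpace_congr surjective_energyCoord).mpr inferInstance

/-! ### The operator is skew-symmetric and surjective -/

/-- The conditions are the rows of the stiffness matrix applied to `d`. Adding `γ` times the third
to the first leaves `C11 * (A d₀ - I₀ d₁) = 0`; the rest follows by elimination and `A I > I₀²`. -/
lemma Params.eq_zero_of_stiffness_eq_zero (p : Params) {d : Fin 3 → ℝ}
    (h₁ : p.C * p.A * d 0 - p.C * p.I₀ * d 1 - p.γ * p.β * p.A * d 2 = 0)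
    (h₂ : p.C * p.I * d 1 - p.C * p.I₀ * d 0 + p.γ * p.β * p.I₀ * d 2 = 0)
    (h₃ : p.β * p.A * d 2 - p.γ * p.β * (p.A * d 0 - p.I₀ * d 1) = 0) : ∀ i, d i = 0 := by
  have e1 : p.A * d 0 - p.I₀ * d 1 = 0 := by
    refine (mul_eq_zero.mp (?_ : p.C11 * (p.A * d 0 - p.I₀ * d 1) = 0)).resolve_left
      p.C11_pos.ne'
    rw [Params.C] at h₁
    linear_combination h₁ + p.γ * h₃
  have e2 : d 2 = 0 := by
    refine (mul_eq_zero.mp (?_ : p.β * p.A * d 2 = 0)).resolve_left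
      (mul_pos p.β_pos p.A_pos).ne'
    linear_combination h₃ + p.γ * p.β * e1
  have e3 : d 1 = 0 := by
    refine (mul_eq_zero.mp (?_ : p.C * (p.A * p.I - p.I₀ ^ 2) * d 1 = 0)).resolve_left
      (mul_pos p.C_pos p.det_pos).ne'
    rw [e2] at h₂
    linear_combination p.A * h₂ + p.C * p.I₀ * e1
  have e4 : d 0 = 0 := by
    refine (mul_eq_zero.mp (?_ : p.A * d 0 = 0)).resolve_left p.A_pos.ne'
    rw [e3] at e1
    linear_combination e1
  intro i
  fin_cases i
  exacts [e4, e3, e2]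

lemma hasBoundaryValue_D_of_mem_opDomain {x : StateSpace p} (hx : x ∈ opDomain p) (i : Fin 3) :
    HasBoundaryValue (x.D i) 1 0 := by
  obtain ⟨-, -, d, hd, h₁, h₂, h₃⟩ := hx
  rw [← p.eq_zero_of_stiffness_eq_zero h₁ h₂ h₃ i]
  exact hd i

lemma inner_weakDeriv_D {x y : StateSpace p} (hx : x ∈ opDomain p) (hy : y ∈ opDomain p)
    (i j : Fin 3) :
    inner ℝ (weakDeriv (x.D i)) (y.2 j) = -inner ℝ (x.D i) (weakDeriv (y.2 j)) :=
  inner_weakDeriv_left (hx.1 i) (hasBoundaryValue_D_of_mem_opDomain hx i) (hy.2.1 j)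

/-- After integration by parts only algebra remains: the mass matrix of the energy times `coeff p`
is its symmetric stiffness matrix, so the potential and kinetic contributions cancel. -/
lemma op_skewSymmetric (x y : (op p).domain) :
    inner ℝ (op p x) (y : StateSpace p) = -inner ℝ (x : StateSpace p) (op p y) := by
  have hA := p.A_pos.ne'
  have hρ := p.ρ_pos.ne'
  have hμ := p.μ_pos.ne'
  have hD : ∀ (x : (op p).domain) i, (op p x).D i = weakDeriv (x.1.2 i) := fun _ _ => rfl
  have hV : ∀ (x : (op p).domain) i,
    (op p x).2 i = ∑ j, coeff p i j • weakDeriv (x.1.D j) := fun _ _ => rfl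
  have k1 := inner_weakDeriv_D x.2 y.2
  have k2 : ∀ i j, inner ℝ (x.1.2 j) (weakDeriv (y.1.D i))
      = -inner ℝ (weakDeriv (x.1.2 j)) (y.1.D i) := fun i j => by
    rw [real_inner_comm, inner_weakDeriv_D y.2 x.2, real_inner_comm]
  rw [StateSpace.inner_eq, StateSpace.inner_eq, energyInner_eq, energyInner_eq]
  simp only [hD, hV, Fin.sum_univ_three, inner_add_left, inner_add_right, real_inner_smul_left,
    real_inner_smul_right, k1, k2]
  simp only [coeff, Matrix.of_apply, Matrix.cons_val', Matrix.cons_val_zero, Matrix.cons_val_one,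
    Matrix.cons_val]
  field_simp
  ring

lemma det_coeff_ne_zero (p : Params) : (coeff p).det ≠ 0 := by
  have h1 := p.A_pos
  have h3 := p.C_pos
  have h4 := p.C11_pos
  have h5 := p.β_pos
  have h6 := p.ρ_pos
  have h7 := p.μ_pos
  have e : (coeff p).det = p.C / p.ρ * (p.β * p.C11 / (p.ρ * p.μ)) := by
    rw [Matrix.det_fin_three]
    simp only [coeff, Matrix.of_apply, Matrix.cons_val', Matrix.cons_val_zero,
      Matrix.cons_val_one, Matrix.cons_val]
    rw [Params.C]
    field_simp
    ring
  rw [e]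
  positivity

/-- The velocities are forced to be `f.1`, and the second derivatives to be `(coeff p)⁻¹` applied to
`f.2`. Integrating from `1` gives first derivatives vanishing there, so the boundary conditions hold
with `d = 0`; integrating from `0` gives the `H10` components. -/
lemma op_surjective (p : Params) : Function.Surjective (op p) := by
  intro f
  have hdet : IsUnit (coeff p).det := (det_coeff_ne_zero p).isUnit
  choose w hw hw1 using fun i =>
    exists_hasWeakDeriv_boundaryValue_one (∑ k, (coeff p)⁻¹ i k • f.2 k)
  have hD : ∀ i, (StateSpace.ofDeriv w fun i => f.1 i : StateSpace p).D i = w i :=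
    StateSpace.D_ofDeriv w _
  have hmem : (StateSpace.ofDeriv w fun i => f.1 i : StateSpace p) ∈ opDomain p := by
    refine ⟨fun i => ?_, fun i => (f.1 i).2, 0, fun i => ?_, by simp, by simp, by simp⟩
    · rw [hD]
      exact ⟨_, hw i⟩
    · rw [hD]
      exact hw1 i
  refine ⟨⟨_, hmem⟩, Prod.ext rfl (funext fun i => ?_)⟩
  change ∑ j, coeff p i j • weakDeriv ((StateSpace.ofDeriv w fun i => f.1 i : StateSpace p).D j)
    = f.2 i
  simp only [hD, (hw _).weakDeriv_eq, Finset.smul_sum, smul_smul]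
  rw [Finset.sum_comm]
  simp only [← Finset.sum_smul, ← Matrix.mul_apply, Matrix.mul_nonsing_inv _ hdet,
    Matrix.one_apply, ite_smul, one_smul, zero_smul, Finset.sum_ite_eq, Finset.mem_univ, if_true]

end PiezoActuator

theorem mainTheorem1 (p : PiezoActuator.Params) :
    ∃ S : PiezoActuator.C0Semigroup (PiezoActuator.StateSpace p),
      S.HasGenerator (PiezoActuator.op p) ∧ ∀ t : ℝ≥0, ‖S.T t‖ ≤ 1 :=
  PiezoActuator.exists_c0Semigroup_of_skewSymmetric_of_surjective
    PiezoActuator.op_skewSymmetric (PiezoActuator.op_surjective p)
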